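/- Let $X$ be a Banach space over $\mathbb F\in\{\mathbb R,\mathbb C\}$, let $\mathcal B(X)$ be the algebra of bounded linear operators on $X$, and let $\mathcal A\subseteq\mathcal B(X)$ be a subalgebra containing the identity $I$ and all finite rank operators (a unital standard operator algebra). For $\xi\in\mathbb F$ write $[A,B]_\xi=AB-\xi BA$. An additive map $L:\mathcal A\to\mathcal B(X)$ is an additive derivation if $L(AB)=L(A)B+AL(B)$ for all $A,B\in\mathcal A$, and an additive $\xi$-Lie derivation if $L([A,B]_\xi)=[L(A),B]_\xi+[A,L(B)]_\xi$ for all $A,B\in\mathcal A$. An additive map $\tau:\mathcal A\to\mathcal B(X)$ is an additive generalized derivation if there is an additive derivation $d:\mathcal A\to\mathcal B(X)$ such that $\tau(AB)=\tau(A)B+Ad(B)$ for all $A,B\in\mathcal A$. An additive map $\delta:\mathcal A\to\mathcal B(X)$ is an additive generalized $\xi$-Lie derivation if there is an additive $\xi$-Lie derivation $L:\mathcal A\to\mathcal B(X)$ such that $\delta([A,B]_\xi)=\delta(A)B-\xi\delta(B)A+AL(B)-\xi BL(A)$ for all $A,B\in\mathcal A$. Theorem 3.3. Let $\xi\in\mathbb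 F$ with $\xi\neq0$ and let $\delta:\mathcal A\to\mathcal B(X)$ be an additive generalized $\xi$-Lie derivation. (1) If $\xi=1$ and $\dim X\ge3$, then there are an additive generalized derivation $\tau:\mathcal A\to\mathcal B(X)$ and an additive map $h:\mathcal A\to\mathbb F$ with $h(AB-BA)=0$ for all $A,B\in\mathcal A$, such that $\delta(A)=\tau(A)+h(A)I$ for all $A\in\mathcal A$. (2) If $\xi\neq1$, then $\delta$ is an additive generalized derivation; if moreover $\dim X\neq1$, then $\delta(\xi A)=\xi\delta(A)$ for all $A\in\mathcal A$. -/

import Mathlib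

namespace XiLie

/-- The `ξ`-Lie product `[a, b]_ξ = a b - ξ b a` in an algebra. For `ξ = 1` this is the commutator. -/
def xiBracket {𝕜 R : Type*} [CommRing 𝕜] [Ring R] [Algebra 𝕜 R] (ξ : 𝕜) (a b : R) : R :=
  a * b - ξ • (b * a)

section Operators

variable {𝕜 X : Type*} [RCLike 𝕜] [NormedAddCommGroup X] [NormedSpace 𝕜 X]

/-- A subalgebra of `B(X)` is a standard operator algebra if it contains all bounded operators of
finite rank. (A `Subalgebra` contains the identity; no closedness is required.) -/
def IsStandardOperatorAlgebra (A : Subalgebra 𝕜 (X →L[𝕜] X)) : Prop :=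
  ∀ T : X →L[𝕜] X, FiniteDimensional 𝕜 (LinearMap.range (T : X →ₗ[𝕜] X)) → T ∈ A

variable {A : Subalgebra 𝕜 (X →L[𝕜] X)}

/-- An additive map `L : A → B(X)` is an additive derivation if `L(ST) = L(S)T + S L(T)`. -/
def IsAdditiveDerivation (L : A →+ (X →L[𝕜] X)) : Prop :=
  ∀ S T : A, L (S * T) = L S * (T : X →L[𝕜] X) + (S : X →L[𝕜] X) * L T

/-- An additive map `δ : A → B(X)` is an additive generalized derivation if there is an additive
derivation `d : A → B(X)` with `δ(ST) = δ(S)T + S d(T)`. -/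
def IsAdditiveGeneralizedDerivation (δ : A →+ (X →L[𝕜] X)) : Prop :=
  ∃ d : A →+ (X →L[𝕜] X), IsAdditiveDerivation d ∧
    ∀ S T : A, δ (S * T) = δ S * (T : X →L[𝕜] X) + (S : X →L[𝕜] X) * d T

/-- An additive map `L : A → B(X)` is an additive `ξ`-Lie derivation if
`L([S, T]_ξ) = [L(S), T]_ξ + [S, L(T)]_ξ`. -/
def IsAdditiveXiLieDerivation (ξ : 𝕜) (L : A →+ (X →L[𝕜] X)) : Prop :=
  ∀ S T : A, L (xiBracket ξ S T) =
    xiBracket ξ (L S) (T : X →L[𝕜] X) + xiBracket ξ (S : X →L[𝕜] X) (L T)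

/-- An additive map `δ : A → B(X)` is an additive generalized `ξ`-Lie derivation if there is an
additive `ξ`-Lie derivation `L : A → B(X)` (the relating one) with
`δ([S, T]_ξ) = δ(S) T - ξ δ(T) S + S L(T) - ξ T L(S)`. -/
def IsAdditiveGeneralizedXiLieDerivation (ξ : 𝕜) (δ : A →+ (X →L[𝕜] X)) : Prop :=
  ∃ L : A →+ (X →L[𝕜] X), IsAdditiveXiLieDerivation ξ L ∧
    ∀ S T : A, δ (xiBracket ξ S T) =
      δ S * (T : X →L[𝕜] X) - ξ • (δ T * (S : X →L[𝕜] X))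
        + (S : X →L[𝕜] X) * L T - ξ • ((T : X →L[𝕜] X) * L S)

end Operators

end XiLie

/-! If `L` is the relating map of `δ`, then `δ - L` turns `[a, b]_ξ` into `φ(a) b - ξ φ(b) a`.
Brackets with `1` make it left multiplication by some `T₀`. A derivation plus a left multiplication
is a generalized derivation, so only `L` matters.

For `ξ = 1`, `L` is a Lie derivation. A Peirce decomposition splits it into a derivation plus a
scalar map (`exists_leibniz_add_scalar`). For `ξ = -1`, `L` is a Jordan derivation, and a
Herstein-type argument shows it is a derivation (`jordan_leibniz`). For other `ξ`, `L 1 = c • 1`,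
and the Leibniz defect of `L` is an explicit multiple of `c`. The cocycle identity forces `c = 0` if
there is a nontrivial idempotent (`xiLie_scalar_eq_zero`). If `dim X ≤ 1`, everything commutes and
`L - c` is a derivation. -/

namespace XiLie

/-! ### Prime action and the Leibniz defect. -/

section Abstract

variable {𝕜 R : Type*} [Field 𝕜] [Ring R] [Algebra 𝕜 R]

/-- A subalgebra `A` of `R` acts primely on `R` if `m A n = 0` forces `m = 0` or `n = 0`, and if for
every idempotent `q ∈ A` the centralizer of `q A q` in `q R q` consists of scalar multiples of `q`. -/
structure ActsPrimely (A : Subalgebra 𝕜 R) : Prop where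
  eq_zero_or : ∀ m n : R, (∀ a : A, m * a * n = 0) → m = 0 ∨ n = 0
  corner_scalar : ∀ q : A, (q * q : R) = q → ∀ m : R, q * m * q = m →
    (∀ a : A, m * (q * a * q) = (q * a * q) * m) → ∃ c : 𝕜, m = c • (q : R)

variable {A : Subalgebra 𝕜 R}

theorem ActsPrimely.exists_eq_smul_one (hA : ActsPrimely A) {m : R}
    (hm : ∀ a : A, m * a = a * m) : ∃ c : 𝕜, m = c • (1 : R) := by
  simpa using hA.corner_scalar 1 (by simp) m (by simp) (by simpa using hm)

/-- The failure of the Leibniz rule for `d` at `(a, b)`. -/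
def leibnizDefect (d : A →+ R) (a b : A) : R :=
  d (a * b) - d a * b - a * d b

theorem leibnizDefect_add_left (d : A →+ R) (a b c : A) :
    leibnizDefect d (a + b) c = leibnizDefect d a c + leibnizDefect d b c := by
  simp only [leibnizDefect, add_mul, map_add, Subalgebra.coe_add]
  abel

theorem leibnizDefect_add_right (d : A →+ R) (a b c : A) :
    leibnizDefect d a (b + c) = leibnizDefect d a b + leibnizDefect d a c := by
  simp only [leibnizDefect, mul_add, map_add, Subalgebra.coe_add]
  abel

/-- The Leibniz defect is a Hochschild `2`-cocycle. -/
theorem leibnizDefect_cocycle (d : A →+ R) (a b c : A) :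
    a * leibnizDefect d b c - leibnizDefect d (a * b) c + leibnizDefect d a (b * c)
      - leibnizDefect d a b * c = 0 := by
  simp only [leibnizDefect, Subalgebra.coe_mul, mul_assoc a b c]
  noncomm_ring

/-! ### Jordan derivations (`ξ = -1`). -/

section Jordan

variable {J : A →+ R}

/-- With `x ∘ y = xy + yx`, apply `J` to `a ∘ (a ∘ b) = a² ∘ b + 2aba` and divide by two. -/
theorem jordan_triple (h2 : (2 : 𝕜) ≠ 0)
    (hJ : ∀ a b : A, J (a * b + b * a) = J a * b + a * J b + J b * a + b * J a) (a b : A) :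
    J (a * b * a) = J a * b * a + a * J b * a + a * b * J a := by
  have h1 := hJ a (a * b + b * a)
  have h3 := hJ (a * a) b
  have h4 := hJ a a
  have h5 := hJ a b
  have e : a * (a * b + b * a) + (a * b + b * a) * a
      = (a * a * b + b * (a * a)) + (a * b * a + a * b * a) := by noncomm_ring
  rw [e, map_add, map_add J (a * b * a)] at h1
  have h6 : (2 : 𝕜) • J (a * a) = (2 : 𝕜) • (J a * a + a * J a) := by
    rw [two_smul, two_smul, ← map_add, h4]; abel
  have h6 := smul_right_injective R h2 h6
  rw [h3, h5, h6] at h1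
  apply smul_right_injective R h2
  simp only [two_smul]
  push_cast at h1
  linear_combination (norm := noncomm_ring) h1

theorem jordan_triple_polarized (h2 : (2 : 𝕜) ≠ 0)
    (hJ : ∀ a b : A, J (a * b + b * a) = J a * b + a * J b + J b * a + b * J a) (a b c : A) :
    J (a * b * c + c * b * a) = J a * b * c + a * J b * c + a * b * J c
      + (J c * b * a + c * J b * a + c * b * J a) := by
  have h1 := jordan_triple h2 hJ (a + c) b
  have e : (a + c) * b * (a + c) = (a * b * c + c * b * a) + a * b * a + c * b * c := by
    noncomm_ring
  rw [e, map_add, map_add, jordan_triple h2 hJ, jordan_triple h2 hJ] at h1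
  push_cast [map_add] at h1 ⊢
  linear_combination (norm := noncomm_ring) h1

/-- A Jordan derivation from a subalgebra acting primely is a derivation. -/
theorem jordan_leibniz (hA : ActsPrimely A) (h2 : (2 : 𝕜) ≠ 0)
    (hJ : ∀ a b : A, J (a * b + b * a) = J a * b + a * J b + J b * a + b * J a) (a b : A) :
    leibnizDefect J a b = 0 := by
  have two {m : R} (h : m + m = 0) : m = 0 := by
    have : (2 : 𝕜) • m = (2 : 𝕜) • (0 : R) := by rw [two_smul, h, smul_zero]
    exact smul_right_injective R h2 this
  have anti (a b : A) : leibnizDefect J b a = - leibnizDefect J a b := by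
    have := hJ a b
    rw [map_add] at this
    simp only [leibnizDefect]
    linear_combination (norm := noncomm_ring) this
  -- Compute `J` of `(ab)x(ba) + (ba)x(ab) = a(bxb)a + b(axa)b` in two ways.
  have key (a b x : A) : leibnizDefect J a b * x * (a * b - b * a : A)
      + (a * b - b * a : A) * x * leibnizDefect J a b = 0 := by
    have h1 := jordan_triple h2 hJ a (b * x * b)
    have h1' := jordan_triple h2 hJ b (a * x * a)
    have h3 := jordan_triple_polarized h2 hJ (a * b) x (b * a)
    have e : a * b * x * (b * a) + b * a * x * (a * b)
      = a * (b * x * b) * a + b * (a * x * a) * b := by noncomm_ring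
    rw [e, map_add, h1, h1', jordan_triple h2 hJ, jordan_triple h2 hJ] at h3
    have h4 : J (b * a) = J b * a + b * J a - leibnizDefect J a b := by
      have := anti a b
      rw [← neg_eq_iff_eq_neg] at this
      rw [← this, leibnizDefect]; abel
    have h5 : J (a * b) = J a * b + a * J b + leibnizDefect J a b := by
      rw [leibnizDefect]; abel
    rw [h4, h5] at h3
    push_cast at h3 ⊢
    linear_combination (norm := noncomm_ring) h3
  have alt (a b : A) : leibnizDefect J a b = 0 ∨ a * b = b * a := by
    set g := leibnizDefect J a b
    set c : A := a * b - b * a with hc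
    have swap (x : A) : g * x * c = - (c * x * g) := eq_neg_of_add_eq_zero_left (key a b x)
    -- Three swaps of `g` with `c` give `gxcyc = -cxcyg = cxgyc = -gxcyc`.
    have h (y x : A) : g * x * (c * y * c : R) = 0 := by
      apply two
      have h1 := swap (x * c * y)
      have h2 := swap x
      have h3 := swap y
      push_cast at h1
      linear_combination (norm := noncomm_ring) h1 - c * x * h3 + h2 * y * c
    by_cases hg : g = 0
    · exact .inl hg
    · right
      have h0 (y : A) := (hA.eq_zero_or g _ (h y)).resolve_left hg
      have := hA.eq_zero_or c c h0
      rw [or_self, ZeroMemClass.coe_eq_zero, hc] at this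
      exact sub_eq_zero.mp this
  by_contra hg
  -- A group is not the union of two proper subgroups: the alternative `alt`, additive in each
  -- argument, makes `a` and then `b` central, hence scalar.
  have left (c : A) : a * c = c * a := by
    by_contra hc
    have h1 := (alt a c).resolve_right hc
    have h3 := (alt a (b + c)).resolve_left (by rwa [leibnizDefect_add_right, h1, add_zero])
    rw [mul_add, add_mul, (alt a b).resolve_left hg] at h3
    exact hc (add_left_cancel h3)
  have right (c : A) : b * c = c * b := by
    by_contra hc
    have h1 := (alt c b).resolve_right (Ne.symm hc)
    have h3 := (alt (a + c) b).resolve_left (by rwa [leibnizDefect_add_left, h1, add_zero])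
    rw [mul_add, add_mul, (alt a b).resolve_left hg] at h3
    exact hc (add_left_cancel h3).symm
  have cast {u v : A} (h : u * v = v * u) : (u * v : R) = v * u := congrArg Subtype.val h
  obtain ⟨s, hs⟩ := hA.exists_eq_smul_one fun c => cast (left c)
  obtain ⟨t, ht⟩ := hA.exists_eq_smul_one fun c => cast (right c)
  apply hg
  apply two
  have h1 := hJ a b
  rw [← left b, map_add, hs, ht] at h1
  simp only [leibnizDefect, hs, ht]
  simp only [smul_mul_assoc, mul_smul_comm, one_mul, mul_one] at h1 ⊢
  linear_combination (norm := abel) h1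

end Jordan

/-! ### `ξ`-Lie derivations with `ξ ≠ ±1`. -/

section XiLieDerivation

variable {ξ : 𝕜} {L : A →+ R}

/-- `[1, a]_ξ = [a, 1]_ξ`, and the two expansions differ by `1 + ξ` times the commutator of `L 1`
with `a`. As `L` is only additive, its failure to commute with `ξ` has to be tracked. -/
theorem xiLie_bracket_one
    (hL : ∀ a b : A, L (xiBracket ξ a b) = xiBracket ξ (L a) (b : R) + xiBracket ξ (a : R) (L b))
    (hA : ActsPrimely A) (h1 : 1 + ξ ≠ 0) : ∃ c : 𝕜, L 1 = c • (1 : R) ∧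
      ∀ a : A, L (ξ • a) = ξ • L a - ((1 - ξ) * c) • (a : R) := by
  have hl (a : A) := hL 1 a
  have hr (a : A) := hL a 1
  simp only [xiBracket, one_mul, mul_one, OneMemClass.coe_one, map_sub] at hl hr
  obtain ⟨c, hc⟩ := hA.exists_eq_smul_one (m := L 1) fun a => by
    have h : (1 + ξ) • (L 1 * (a : R)) = (1 + ξ) • ((a : R) * L 1) := by
      linear_combination (norm := module) hr a - hl a
    exact smul_right_injective R h1 h
  refine ⟨c, hc, fun a => ?_⟩
  have := hl a
  rw [hc] at this
  simp only [smul_mul_assoc, mul_smul_comm, one_mul, mul_one] at this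
  linear_combination (norm := module) -this

/-- The bracket rule relates the defects at `(a, b)` and `(b, a)`; adding `ξ` times the swapped
relation eliminates the latter. -/
theorem xiLie_leibnizDefect
    (hL : ∀ a b : A, L (xiBracket ξ a b) = xiBracket ξ (L a) (b : R) + xiBracket ξ (a : R) (L b))
    (h2 : ξ ≠ 1) {c : 𝕜}
    (hc : ∀ a : A, L (ξ • a) = ξ • L a - ((1 - ξ) * c) • (a : R)) (a b : A) :
    (1 + ξ) • leibnizDefect L a b = -(c • (b * a + ξ • (a * b : R))) := by
  have h (a b : A) : leibnizDefect L a b - ξ • leibnizDefect L b a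
      = -(((1 - ξ) * c) • (b * a : R)) := by
    have := hL a b
    simp only [xiBracket, map_sub, hc] at this
    push_cast at this
    simp only [leibnizDefect]
    linear_combination (norm := module) this
  apply smul_right_injective R (sub_ne_zero.mpr h2.symm)
  linear_combination (norm := module) h a b + ξ • h b a

/-- On an algebra with a nontrivial idempotent, a `ξ`-Lie derivation with `ξ ≠ ±1` kills `1`. -/
theorem xiLie_scalar_eq_zero (hA : ActsPrimely A) {p : A} (hp : p * p = p) (hp0 : (p : R) ≠ 0)
    (hp1 : (1 - p : R) ≠ 0) {c : 𝕜}
    (h : ∀ a b : A, (1 + ξ) • leibnizDefect L a b = -(c • (b * a + ξ • (a * b : R)))) :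
    c = 0 := by
  by_contra hc
  have hp' : (p * p : R) = p := congrArg Subtype.val hp
  have comm (a : A) : (p : R) * a * (1 - p) = 0 := by
    -- The product `(a, b) ↦ ab` is itself a cocycle, so only the `ba` term contributes, giving `c
    -- [[x, z], y] = 0`.
    have key (x y z : A) : c • ((x * z - z * x) * y - y * (x * z - z * x) : R) = 0 := by
      have e := congrArg ((1 + ξ) • ·) (leibnizDefect_cocycle L x y z)
      rw [smul_sub, smul_add, smul_sub, smul_zero, ← mul_smul_comm, ← smul_mul_assoc, h, h, h, h] at e
      push_cast at e
      simp only [neg_mul, mul_neg, smul_mul_assoc, mul_smul_comm, mul_add, add_mul, mul_assoc] at e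
      simp only [mul_sub, sub_mul, mul_assoc]
      linear_combination (norm := module) -e
    have := (smul_eq_zero.mp (key p p (p * a * (1 - p)))).resolve_left hc
    push_cast at this
    have hq : (1 - p : R) * p = 0 := by rw [sub_mul, one_mul, hp', sub_self]
    have e1 : (p : R) * (p * a * (1 - p)) = p * a * (1 - p) := by
      rw [mul_assoc, ← mul_assoc, hp']
    rw [mul_assoc (p * a : R), hq, mul_zero, sub_zero, e1, e1, mul_assoc (p * a : R), hq,
      mul_zero, zero_sub, neg_eq_zero] at this
    exact this
  rcases hA.eq_zero_or _ _ comm with h | h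
  exacts [hp0 h, hp1 h]

end XiLieDerivation

/-- An additive map with `φ([a, b]_ξ) = φ(a) b - ξ φ(b) a` is a left multiplication. -/
theorem eq_left_mul_of_map_xiBracket {ξ : 𝕜} {φ : A →+ R}
    (hφ : ∀ a b : A, φ (xiBracket ξ a b) = φ a * b - ξ • (φ b * a)) (a : A) :
    φ a = φ 1 * a := by
  have hl := hφ 1 a
  have hr := hφ a 1
  simp only [xiBracket, one_mul, mul_one, OneMemClass.coe_one] at hl hr
  -- At `ξ = -1` the two brackets with `1` give the same equation, but additivity alone evaluates `φ
  -- (a + a)`.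
  by_cases h : 1 + ξ = 0
  · obtain rfl : ξ = -1 := by linear_combination h
    have e : a - (-1 : 𝕜) • a = a + a := by module
    rw [e, map_add] at hl
    linear_combination (norm := module) hl
  · have : (1 + ξ) • φ a = (1 + ξ) • (φ 1 * (a : R)) := by
      linear_combination (norm := module) hl - hr
    exact smul_right_injective R h this

end Abstract

end XiLie

namespace XiLie

/-! ### Lie derivations (`ξ = 1`) via Peirce corners. -/

section Lie

variable {𝕜 R : Type*} [Field 𝕜] [Ring R] [Algebra 𝕜 R]

theorem bool_eq_not_of_ne {i j : Bool} (h : i ≠ j) : j = !i := by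
  revert i j
  decide

/-- `m` lies in the Peirce corner `p R q`, for idempotents `p` and `q`. -/
def InCorner (p q m : R) : Prop :=
  p * m = m ∧ m * q = m

theorem InCorner.mul {p q r s m n : R} (hm : InCorner p q m) (hn : InCorner r s n) :
    InCorner p s (m * n) :=
  ⟨by rw [← mul_assoc, hm.1], by rw [mul_assoc, hn.2]⟩

theorem InCorner.mul_eq_zero {p q r s m n : R} (hm : InCorner p q m) (hn : InCorner r s n)
    (h : q * r = 0) : m * n = 0 := by
  rw [← hm.2, ← hn.1, mul_assoc, ← mul_assoc q, h, zero_mul, mul_zero]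

theorem inCorner_mul_mul {p q : R} (hp : p * p = p) (hq : q * q = q) (m : R) :
    InCorner p q (p * m * q) :=
  ⟨by rw [← mul_assoc, ← mul_assoc, hp], by rw [mul_assoc, hq]⟩

/-- Two complementary idempotents, indexed by `Bool`. -/
structure IsPeircePair (e : Bool → R) : Prop where
  idem : ∀ i, e i * e i = e i
  ortho : ∀ i, e i * e (!i) = 0
  add_eq_one : ∀ i, e i + e (!i) = 1
  ne_zero : ∀ i, e i ≠ 0

theorem isPeircePair_of_idempotent {p : R} (hp : p * p = p) (hp0 : p ≠ 0) (hp1 : 1 - p ≠ 0) :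
    IsPeircePair (fun i : Bool => bif i then p else 1 - p) where
  idem := by rintro (_ | _) <;> simp [mul_sub, sub_mul, hp]
  ortho := by rintro (_ | _) <;> simp [mul_sub, sub_mul, hp]
  add_eq_one := by rintro (_ | _) <;> simp
  ne_zero := by rintro (_ | _) <;> simpa

theorem IsPeircePair.ortho' {e : Bool → R} (he : IsPeircePair e) (i : Bool) :
    e (!i) * e i = 0 := by
  simpa using he.ortho (!i)

theorem IsPeircePair.mul_eq_self {e : Bool → R} (he : IsPeircePair e) {i : Bool} {m : R}
    (h : e (!i) * m = 0) : e i * m = m := by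
  have := congrArg (· * m) (he.add_eq_one i)
  simpa [add_mul, h] using this

theorem IsPeircePair.self_mul_eq {e : Bool → R} (he : IsPeircePair e) {i : Bool} {m : R}
    (h : m * e (!i) = 0) : m * e i = m := by
  have := congrArg (m * ·) (he.add_eq_one i)
  simpa [mul_add, h] using this

variable {A : Subalgebra 𝕜 R} {e : Bool → A}

/-- An additive map that respects the Peirce corners and is a Lie derivation up to a scalar
correction `h` vanishing on the off-diagonal corners is a derivation. -/
theorem leibnizDefect_eq_zero_of_peirce (hA : ActsPrimely A) (h2 : (2 : 𝕜) ≠ 0)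
    (he : IsPeircePair fun i => (e i : R)) {d : A →+ R} {h : A →+ 𝕜}
    (hd : ∀ a b : A, d (a * b - b * a)
      = d a * b + a * d b - d b * a - b * d a - h (a * b - b * a) • (1 : R))
    (hcorner : ∀ i j (a : A), InCorner (e i : R) (e j) a → InCorner (e i : R) (e j) (d a))
    (hoff : ∀ i (a : A), InCorner (e i : R) (e (!i)) a → h a = 0) (a b : A) :
    leibnizDefect d a b = 0 := by
  have ne_not (i : Bool) : i ≠ !i := by simp
  have ortho {i j} (hij : i ≠ j) : (e i * e j : R) = 0 := by
    obtain rfl : j = !i := bool_eq_not_of_ne hij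
    exact he.ortho i
  -- the defect vanishes unless the outer indices agree
  have outer {i j k l} (hil : i ≠ l) {a b : A} (ha : InCorner (e i : R) (e j) a)
      (hb : InCorner (e k : R) (e l) b) : leibnizDefect d a b = 0 := by
    have h1 := hd a b
    have e1 : b * a = 0 := Subtype.ext (hb.mul_eq_zero ha (ortho hil.symm))
    have e2 := (hcorner _ _ _ hb).mul_eq_zero ha (ortho hil.symm)
    have e3 := hb.mul_eq_zero (hcorner _ _ _ ha) (ortho hil.symm)
    have e4 : h (a * b) = 0 := by
      obtain rfl : l = !i := bool_eq_not_of_ne hil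
      exact hoff i _ (ha.mul hb)
    rw [e1, sub_zero, e2, e3, e4] at h1
    rw [leibnizDefect, h1]
    simp
  have inner {i j k l} (hjk : j ≠ k) {a b : A} (ha : InCorner (e i : R) (e j) a)
      (hb : InCorner (e k : R) (e l) b) : leibnizDefect d a b = 0 := by
    have e1 : a * b = 0 := Subtype.ext (ha.mul_eq_zero hb (ortho hjk))
    rw [leibnizDefect, e1, (hcorner _ _ _ ha).mul_eq_zero hb (ortho hjk),
      ha.mul_eq_zero (hcorner _ _ _ hb) (ortho hjk)]
    simp
  have defect {i j k} {a b : A} (ha : InCorner (e i : R) (e j) a)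
      (hb : InCorner (e j : R) (e k) b) : InCorner (e i : R) (e k) (leibnizDefect d a b) := by
    have h1 := hcorner _ _ (a * b) (ha.mul hb)
    have h3 := (hcorner _ _ _ ha).mul hb
    have h4 := ha.mul (hcorner _ _ _ hb)
    rw [leibnizDefect]
    exact ⟨by rw [mul_sub, mul_sub, h1.1, h3.1, h4.1], by rw [sub_mul, sub_mul, h1.2, h3.2, h4.2]⟩
  have diag {i} {a b : A} (ha : InCorner (e i : R) (e i) a)
      (hb : InCorner (e i : R) (e i) b) : leibnizDefect d a b = 0 := by
    -- In the cocycle identity with third entry in the `(i, !i)` corner, three terms are already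
    -- known to vanish.
    have key (x : A) : leibnizDefect d a b * x * (e (!i) : R) = 0 := by
      have hx : InCorner (e i : R) (e (!i)) (e i * x * e (!i) : A) :=
        inCorner_mul_mul (he.idem _) (he.idem _) _
      have := leibnizDefect_cocycle d a b (e i * x * e (!i))
      rw [outer (ne_not i) hb hx, outer (ne_not i) (ha.mul hb) hx, outer (ne_not i) ha (hb.mul hx)]
        at this
      push_cast at this
      rw [← mul_assoc, ← mul_assoc, (defect ha hb).2] at this
      simpa using this
    exact (hA.eq_zero_or _ _ key).resolve_right (he.ne_zero _)
  have off {i} {a b : A} (ha : InCorner (e i : R) (e (!i)) a)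
      (hb : InCorner (e (!i) : R) (e i) b) : leibnizDefect d a b = 0 := by
    have h1 := hd a b
    set c := h (a * b - b * a)
    have e0 : leibnizDefect d a b - leibnizDefect d b a = - (c • (1 : R)) := by
      rw [map_sub] at h1
      simp only [leibnizDefect]
      linear_combination (norm := abel) h1
    have e1 : leibnizDefect d a b = -(c • (e i : R)) := by
      have := congrArg ((e i : R) * ·) e0
      have h3 := (defect ha hb).1
      have h4 := (defect hb ha).1
      simp only [mul_sub, h3, mul_neg, mul_smul_comm, mul_one] at this
      rw [← h4, ← mul_assoc, he.ortho i, zero_mul, sub_zero] at this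
      exact this
    have e2 : leibnizDefect d b a = c • (e (!i) : R) := by
      have h5 : (1 : R) = e i + e (!i) := (he.add_eq_one i).symm
      rw [e1, h5] at e0
      linear_combination (norm := module) -e0
    -- The two defects are now `-c e_i` and `c e_{!i}`; the cocycle identity at `(a, b, a)` reads
    -- `2ca = 0`.
    have h3 := leibnizDefect_cocycle d a b a
    rw [outer (ne_not i) (a := a * b) (ha.mul hb) ha,
      outer (ne_not i) (b := b * a) ha (hb.mul ha), e1, e2, mul_smul_comm,
      neg_mul, smul_mul_assoc, ha.1, ha.2] at h3
    have h4 : (2 * c) • (a : R) = 0 := by linear_combination (norm := module) h3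
    rcases smul_eq_zero.mp h4 with h5 | h5
    · rw [e1, (mul_eq_zero.mp h5).resolve_left h2]
      simp
    · obtain rfl : a = 0 := Subtype.ext h5
      simp [leibnizDefect]
  have off' {j} {a b : A} (ha : InCorner (e (!j) : R) (e j) a)
      (hb : InCorner (e j : R) (e (!j)) b) : leibnizDefect d a b = 0 :=
    off (i := !j) (by simpa using ha) (by simpa using hb)
  have corners {i j k l} {a b : A} (ha : InCorner (e i : R) (e j) a)
      (hb : InCorner (e k : R) (e l) b) : leibnizDefect d a b = 0 := by
    by_cases hjk : j = k
    · subst hjk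
      by_cases hil : i = l
      · subst hil
        by_cases hij : j = i
        · subst hij
          exact diag ha hb
        · obtain rfl : i = !j := bool_eq_not_of_ne hij
          exact off' ha hb
      · exact outer hil ha hb
    · exact inner hjk ha hb
  have decomp (a : A) : a = e true * a * e true + e true * a * e false
      + (e false * a * e true + e false * a * e false) := by
    have h1 : e true + e false = 1 := Subtype.ext (he.add_eq_one true)
    calc a = (e true + e false) * a * (e true + e false) := by rw [h1, one_mul, mul_one]
      _ = _ := by noncomm_ring
  have hin (a : A) (i j : Bool) : InCorner (e i : R) (e j) (e i * a * e j : A) :=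
    inCorner_mul_mul (he.idem i) (he.idem j) a
  rw [decomp a, decomp b]
  simp only [leibnizDefect_add_left, leibnizDefect_add_right, corners (hin _ _ _) (hin _ _ _),
    add_zero]

/-- A Lie derivation whose values at the two idempotents are diagonal splits as the sum of a
derivation and a scalar map. -/
theorem exists_leibniz_add_scalar_of_diagonal (hA : ActsPrimely A) (h2 : (2 : 𝕜) ≠ 0)
    (he : IsPeircePair fun i => (e i : R)) {L : A →+ R}
    (hL : ∀ a b : A, L (a * b - b * a) = L a * b - b * L a + (a * L b - L b * a))
    (hdiag : ∀ i j, (e j : R) * L (e i) * e (!j) = 0) :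
    ∃ (d : A →+ R) (h : A →+ 𝕜), (∀ a b, leibnizDefect d a b = 0) ∧
      ∀ a, L a = d a + h a • (1 : R) := by
  have two {m : R} (h : m + m = 0) : m = 0 := by
    have : (2 : 𝕜) • m = (2 : 𝕜) • (0 : R) := by rw [two_smul, h, smul_zero]
    exact smul_right_injective R h2 this
  have hdiag' (i j) : (e (!j) : R) * L (e i) * e j = 0 := by simpa using hdiag i (!j)
  -- Here `a = [e_i, a]`, so the Lie rule applied to this commutator locates `L a`.
  have L_off {i} {a : A} (ha : InCorner (e i : R) (e (!i)) a) :
      InCorner (e i : R) (e (!i)) (L a) := by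
    have ha1 : (e i : R) * a = a := ha.1
    have ha2 : (a : R) * e (!i) = a := ha.2
    have ha3 : (a : R) * e i = 0 := by rw [← ha2, mul_assoc, he.ortho', mul_zero]
    have ha4 : (e (!i) : R) * a = 0 := by rw [← ha1, ← mul_assoc, he.ortho', zero_mul]
    have hi : (e i * e i : R) = e i := he.idem i
    have ho : (e (!i) * e i : R) = 0 := he.ortho' i
    have h1 := hL (e i) a
    have e1 : e i * a - a * e i = a := Subtype.ext (by simp [ha1, ha3])
    rw [e1] at h1
    have h3 : (e (!i) : R) * L (e i) * a = 0 := by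
      rw [← ha1, ← mul_assoc, hdiag', zero_mul]
    have h4 : (a : R) * L (e i) * e i = 0 := by
      rw [← ha2, mul_assoc, mul_assoc, ← mul_assoc (e (!i) : R), hdiag', mul_zero]
    have h5 : (e (!i) : R) * L a = - (e (!i) * L a * e i) := by
      linear_combination (norm := noncomm_ring) (e (!i) : R) * h1 + h3 - ha4 * L (e i) + ho * L a
    have h6 : (e (!i) : R) * L a * e i = 0 := by
      apply two
      linear_combination (norm := noncomm_ring) h5 * (e i : R) - e (!i) * L a * hi
    have h7 : (e (!i) : R) * L a = 0 := by rw [h5, h6, neg_zero]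
    have h8 : (e i : R) * L a = L a := he.mul_eq_self h7
    refine ⟨h8, ?_⟩
    have h9 : L a * e i = 0 := by
      linear_combination (norm := noncomm_ring)
        h1 * (e i : R) + L (e i) * ha3 - h4 + h8 * (e i : R) - L a * hi
    exact he.self_mul_eq (i := !i) (by simpa using h9)
  have L_diag {i} {a : A} (ha : InCorner (e i : R) (e i) a) (j : Bool) :
      (e j : R) * L a * e (!j) = 0 := by
    have ha1 : (e i : R) * a = a := ha.1
    have ha2 : (a : R) * e i = a := ha.2
    have ha3 : (a : R) * e (!i) = 0 := by rw [← ha2, mul_assoc, he.ortho, mul_zero]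
    have ha4 : (e (!i) : R) * a = 0 := by rw [← ha1, ← mul_assoc, he.ortho', zero_mul]
    have hi : (e i * e i : R) = e i := he.idem i
    have ho : (e (!i) * e i : R) = 0 := he.ortho' i
    have ho' : (e i * e (!i) : R) = 0 := he.ortho i
    have h1 := hL a (e i)
    have e1 : a * e i - e i * a = 0 := Subtype.ext (by simp [ha1, ha2])
    rw [e1, map_zero] at h1
    have h3 : (e (!i) : R) * L (e i) * a = 0 := by
      rw [← ha1, ← mul_assoc, hdiag', zero_mul]
    have h4 : (a : R) * L (e i) * e (!i) = 0 := by
      rw [← ha2, mul_assoc, mul_assoc, ← mul_assoc (e i : R), hdiag, mul_zero]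
    by_cases hij : i = j
    · subst hij
      linear_combination (norm := noncomm_ring) e i * h1 * e (!i) + e i * L a * ho'
        - hi * L a * e (!i) + e i * h4 - e i * L (e i) * ha3
    · obtain rfl : j = !i := bool_eq_not_of_ne hij
      rw [Bool.not_not]
      linear_combination (norm := noncomm_ring) -(e (!i) * h1 * e i) - e (!i) * L a * hi
        + ho * L a * e i - ha4 * L (e i) * e i + h3 * e i
  -- Elements of opposite diagonal corners commute, so the opposite corner of `L u` centralizes that
  -- corner of `A`. These scalars, summed over both corners, form the correction `h`.
  have scalar (i : Bool) (a : A) : ∃ c : 𝕜,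
      (e (!i) : R) * L (e i * a * e i) * e (!i) = c • (e (!i) : R) := by
    have ha : InCorner (e i : R) (e i) (e i * a * e i : A) :=
      inCorner_mul_mul (he.idem _) (he.idem _) _
    set u := e i * a * e i
    have hj : (e (!i) * e (!i) : R) = e (!i) := he.idem (!i)
    refine hA.corner_scalar (e (!i)) hj _ ?_ fun b => ?_
    · linear_combination (norm := noncomm_ring) hj * L u * e (!i) + e (!i) * (e (!i) : R) * L u * hj
    · have hb : InCorner (e (!i) : R) (e (!i)) (e (!i) * b * e (!i) : A) :=
        inCorner_mul_mul (he.idem _) (he.idem _) _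
      have hb1 := hb.1
      have hb2 := hb.2
      have e1 : u * (e (!i) * b * e (!i)) - (e (!i) * b * e (!i)) * u = 0 := by
        rw [sub_eq_zero]
        exact Subtype.ext
          ((ha.mul_eq_zero hb (he.ortho i)).trans (hb.mul_eq_zero ha (he.ortho' i)).symm)
      have hv : (e (!i) * b * e (!i) : R) = (e (!i) * b * e (!i) : A) := rfl
      rw [hv]
      set v := e (!i) * b * e (!i)
      have hu1 : (e (!i) * u : R) = 0 := by rw [← ha.1, ← mul_assoc, he.ortho', zero_mul]
      have hu2 : (u * e (!i) : R) = 0 := by rw [← ha.2, mul_assoc, he.ortho, mul_zero]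
      have h1 := hL u v
      rw [e1, map_zero] at h1
      linear_combination (norm := noncomm_ring) -(e (!i) * h1 * e (!i)) + e (!i) * L u * hb1
        - e (!i) * L u * hb2 - hb2 * L u * e (!i) + hb1 * L u * e (!i)
        - hu1 * L v * e (!i) + e (!i) * L v * hu2
  choose c hc using scalar
  have c_add (i : Bool) (a b : A) : c i (a + b) = c i a + c i b := by
    apply smul_left_injective 𝕜 (he.ne_zero (!i))
    simp only [add_smul, ← hc, mul_add, add_mul, map_add]
  let h : A →+ 𝕜 := AddMonoidHom.mk' (fun a => c true a + c false a) fun a b => by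
    rw [c_add, c_add]; abel
  have h_apply (i : Bool) (a : A) : h a = c i a + c (!i) a := by
    cases i
    · exact add_comm _ _
    · rfl
  have c_eq_zero {i : Bool} {a : A} (ha : (e i * a * e i : R) = 0) : c i a = 0 := by
    have h1 := hc i a
    have h3 : e i * a * e i = 0 := Subtype.ext ha
    rw [h3, map_zero, mul_zero, zero_mul] at h1
    exact (smul_eq_zero.mp h1.symm).resolve_right (he.ne_zero (!i))
  have h_off (i) (a : A) (ha : InCorner (e i : R) (e (!i)) a) : h a = 0 := by
    rw [h_apply i, c_eq_zero, c_eq_zero, add_zero]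
    · rw [mul_assoc, ha.2, ← ha.1, ← mul_assoc, he.ortho', zero_mul]
    · rw [ha.1, ← ha.2, mul_assoc, he.ortho', mul_zero]
  have h_diag (i) (a : A) (ha : InCorner (e i : R) (e i) a) :
      (e (!i) : R) * L a * e (!i) = h a • (e (!i) : R) := by
    have h1 : e i * a * e i = a := Subtype.ext (by
      change (e i * a * e i : R) = a
      rw [ha.1, ha.2])
    rw [h_apply i, c_eq_zero (i := !i), add_zero, ← hc, h1]
    rw [← ha.1, ← mul_assoc, he.ortho', zero_mul, zero_mul]
  let d : A →+ R := L - (LinearMap.toSpanSingleton 𝕜 R 1).toAddMonoidHom.comp h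
  have d_apply (a : A) : d a = L a - h a • (1 : R) := rfl
  refine ⟨d, h, leibnizDefect_eq_zero_of_peirce hA h2 he (h := h) (fun a b => ?_)
    (fun i j a ha => ?_) h_off, fun a => ?_⟩
  · simp only [d_apply, hL, sub_mul, mul_sub, smul_mul_assoc, mul_smul_comm, one_mul, mul_one]
    abel
  · by_cases hij : i = j
    · subst hij
      have h3 := h_diag i a ha
      have h4 : (e (!i) : R) * L a * e i = 0 := by simpa using L_diag ha (!i)
      have h5 := L_diag ha i
      have h6 : (e (!i) : R) * d a = 0 := by
        have : (e (!i) : R) * L a * (e i + e (!i)) = e (!i) * L a := by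
          rw [he.add_eq_one i, mul_one]
        rw [mul_add, h4, h3, zero_add] at this
        rw [d_apply, mul_sub, ← this, mul_smul_comm, mul_one, sub_self]
      have h7 : d a * (e (!i) : R) = 0 := by
        have : (e i + e (!i) : R) * (L a * e (!i)) = L a * e (!i) := by
          rw [he.add_eq_one i, one_mul]
        rw [add_mul, ← mul_assoc, ← mul_assoc, h5, h3, zero_add] at this
        rw [d_apply, sub_mul, ← this, smul_mul_assoc, one_mul, sub_self]
      exact ⟨he.mul_eq_self h6, he.self_mul_eq h7⟩
    · obtain rfl : j = !i := bool_eq_not_of_ne hij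
      rw [d_apply, h_off i a ha, zero_smul, sub_zero]
      exact L_off ha
  · rw [d_apply, sub_add_cancel]

/-- A Lie derivation on a subalgebra that acts primely and contains a nontrivial idempotent is the
sum of a derivation and a scalar map. -/
theorem exists_leibniz_add_scalar (hA : ActsPrimely A) (h2 : (2 : 𝕜) ≠ 0) {p : A}
    (hp : (p * p : R) = p) (hp0 : (p : R) ≠ 0) (hp1 : (1 - p : R) ≠ 0) {L : A →+ R}
    (hL : ∀ a b : A, L (a * b - b * a) = L a * b - b * L a + (a * L b - L b * a)) :
    ∃ (d : A →+ R) (h : A →+ 𝕜), (∀ a b, leibnizDefect d a b = 0) ∧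
      (∀ a b, h (a * b - b * a) = 0) ∧ ∀ a, L a = d a + h a • (1 : R) := by
  let e : Bool → A := fun i => bif i then p else 1 - p
  have he : IsPeircePair fun i => (e i : R) := by
    convert isPeircePair_of_idempotent hp hp0 hp1 using 2 with i
    cases i <;> simp [e]
  -- Chosen so that `[t, p]` is the off-diagonal part of `L p`; subtracting this inner derivation
  -- makes the value at `p` diagonal.
  let t : R := (1 - p) * L p * p - p * L p * (1 - p)
  let ad : A →+ R := (AddMonoidHom.mulLeft t - AddMonoidHom.mulRight t).comp
    A.val.toAddMonoidHom
  have ad_apply (a : A) : ad a = t * a - a * t := rfl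
  -- This makes the value at `1 - p` diagonal as well.
  have hL1 (a : A) : L 1 * a = a * L 1 := by
    have := hL 1 a
    simp only [one_mul, mul_one, sub_self, map_zero, OneMemClass.coe_one, add_zero] at this
    linear_combination (norm := noncomm_ring) -this
  have hqq : (1 - p : R) * (1 - p) = 1 - p := by
    linear_combination (norm := noncomm_ring) hp
  have hpq : (p : R) * (1 - p) = 0 := by linear_combination (norm := noncomm_ring) -hp
  have hqp : (1 - p : R) * p = 0 := by linear_combination (norm := noncomm_ring) -hp
  have hD (m u v : R) (huu : u * u = u) (hvv : v * v = v) (huv : u * v = 0) :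
      u * (m - ((v * m * u - u * m * v) * u - u * (v * m * u - u * m * v))) * v = 0 := by
    have : u * (m - ((v * m * u - u * m * v) * u - u * (v * m * u - u * m * v))) * v
        = u * m * v - (u * v) * m * (u * u) * v + (u * u) * m * v * (u * v)
          + (u * u * v) * m * (u * v) - (u * u) * u * m * (v * v) := by noncomm_ring
    rw [this, huu, hvv, huv, huu]
    simp
  have hpD : (p : R) * (L - ad) p * (1 - p) = 0 := hD (L p) p (1 - p) hp hqq hpq
  have hD' (m u v : R) (huu : u * u = u) (hvv : v * v = v) (hvu : v * u = 0) :
      v * (m - ((v * m * u - u * m * v) * u - u * (v * m * u - u * m * v))) * u = 0 := by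
    have : v * (m - ((v * m * u - u * m * v) * u - u * (v * m * u - u * m * v))) * u
        = v * m * u - (v * v) * m * (u * u * u) + (v * u) * m * (v * u) * u
          + (v * u) * v * m * u * u - (v * u) * u * m * v * u := by noncomm_ring
    rw [this, huu, hvv, hvu, huu]
    simp
  have hDp : (1 - p : R) * (L - ad) p * p = 0 := hD' (L p) p (1 - p) hp hqq hqp
  have hD1 : (L - ad) (1 - p) = L 1 - (L - ad) p := by
    simp only [AddMonoidHom.sub_apply, map_sub, ad_apply, OneMemClass.coe_one]
    noncomm_ring
  obtain ⟨d, h, hd, hh⟩ := exists_leibniz_add_scalar_of_diagonal (L := L - ad) hA h2 he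
    (fun a b => by
      simp only [AddMonoidHom.sub_apply, hL, ad_apply]
      push_cast
      noncomm_ring)
    (by
      have hL1p : (p : R) * L 1 * (1 - p) = 0 := by
        rw [← hL1, mul_assoc, hpq, mul_zero]
      have hL1q : (1 - p : R) * L 1 * p = 0 := by
        rw [mul_assoc, hL1, ← mul_assoc, hqp, zero_mul]
      rintro (_ | _) (_ | _)
      · change ((1 - p : A) : R) * (L - ad) (1 - p) * p = 0
        rw [hD1, mul_sub, sub_mul]
        simpa [hL1q] using hDp
      · change (p : R) * (L - ad) (1 - p) * (1 - p : A) = 0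
        rw [hD1, mul_sub, sub_mul]
        simpa [hL1p] using hpD
      · exact hDp
      · exact hpD)
  have hd' (a b : A) : leibnizDefect (d + ad) a b = 0 := by
    have := hd a b
    simp only [leibnizDefect, AddMonoidHom.add_apply, ad_apply] at this ⊢
    push_cast
    linear_combination (norm := noncomm_ring) this
  have hL' (a : A) : L a = (d + ad) a + h a • (1 : R) := by
    have := hh a
    rw [AddMonoidHom.sub_apply] at this
    rw [AddMonoidHom.add_apply]
    linear_combination (norm := abel) this
  refine ⟨d + ad, h, hd', fun a b => ?_, hL'⟩
  have h1 := hL a b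
  have h3 := hd' a b
  have h4 := hd' b a
  simp only [leibnizDefect] at h3 h4
  rw [hL', hL', hL', map_sub] at h1
  simp only [add_mul, mul_add, smul_mul_assoc, mul_smul_comm, one_mul, mul_one] at h1
  -- The scalar parts of `L a` and `L b` cancel in commutators, so `L` and `d` agree on `[a, b]`.
  have h5 : h (a * b - b * a) • (1 : R) = 0 := by
    linear_combination (norm := abel) h1 - h3 + h4
  have : (1 : R) ≠ 0 := fun h0 => hp0 (by rw [← one_mul (p : R), h0, zero_mul])
  exact (smul_eq_zero.mp h5).resolve_right this

end Lie

end XiLie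

namespace XiLie

/-! ### Standard operator algebras and the main theorem. -/

section Operators

variable {𝕜 X : Type*} [RCLike 𝕜] [NormedAddCommGroup X] [NormedSpace 𝕜 X]

variable {A : Subalgebra 𝕜 (X →L[𝕜] X)}

theorem IsStandardOperatorAlgebra.smulRight_mem (hA : IsStandardOperatorAlgebra A)
    (f : StrongDual 𝕜 X) (x : X) : f.smulRight x ∈ A := by
  apply hA
  refine Submodule.finiteDimensional_of_le (S₂ := Submodule.span 𝕜 {x}) ?_
  rintro _ ⟨y, rfl⟩
  exact Submodule.smul_mem _ _ (Submodule.mem_span_singleton_self x)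

/-- Rank-one operators, with functionals supplied by Hahn–Banach, suffice as test elements. -/
theorem IsStandardOperatorAlgebra.actsPrimely (hA : IsStandardOperatorAlgebra A) :
    ActsPrimely A where
  eq_zero_or m n h := by
    by_contra! hmn
    obtain ⟨y, hy⟩ := DFunLike.ne_iff.mp hmn.2
    obtain ⟨x, hx⟩ := DFunLike.ne_iff.mp hmn.1
    obtain ⟨f, hf⟩ := SeparatingDual.exists_eq_one (R := 𝕜) hy
    have := DFunLike.congr_fun (h ⟨f.smulRight x, hA.smulRight_mem f x⟩) y
    simp [hf] at this
    exact hx this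
  corner_scalar q hq m hm h := by
    by_cases hq0 : (q : X →L[𝕜] X) = 0
    · exact ⟨0, by rw [← hm, hq0]; simp⟩
    obtain ⟨y, hy⟩ := DFunLike.ne_iff.mp hq0
    obtain ⟨f, hf⟩ := SeparatingDual.exists_eq_one (R := 𝕜) hy
    -- With `f (q y) = 1`, commutation with `q (f.smulRight x) q` evaluated at `y` gives `m x = f (q
    -- (m y)) • q x`.
    refine ⟨f (q.1 (m y)), ?_⟩
    have hmq : m * q = m := by rw [← hm, mul_assoc, hq]
    ext x
    have := DFunLike.congr_fun (h ⟨f.smulRight x, hA.smulRight_mem f x⟩) y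
    simp [hf] at this
    have e : m x = m (q.1 x) := (DFunLike.congr_fun hmq x).symm
    simpa [e] using this

theorem IsStandardOperatorAlgebra.exists_idempotent (hA : IsStandardOperatorAlgebra A)
    (hX : 1 < Module.rank 𝕜 X) :
    ∃ p : A, (p * p : X →L[𝕜] X) = p ∧ (p : X →L[𝕜] X) ≠ 0 ∧ (1 - p : X →L[𝕜] X) ≠ 0 := by
  have : Nontrivial X := by
    apply (rank_pos_iff_nontrivial (R := 𝕜)).mp
    exact zero_lt_one.trans hX
  obtain ⟨x, hx⟩ := exists_ne (0 : X)
  obtain ⟨f, hf⟩ := SeparatingDual.exists_eq_one (R := 𝕜) hx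
  refine ⟨⟨f.smulRight x, hA.smulRight_mem f x⟩, ?_, fun h => ?_, fun h => ?_⟩
  · ext y
    simp [hf]
  · have := DFunLike.congr_fun h x
    simp [hf, hx] at this
  · refine hX.not_ge (rank_le_one_iff.mpr ⟨x, fun y => ⟨f y, ?_⟩⟩)
    have := DFunLike.congr_fun h y
    simp at this
    exact (sub_eq_zero.mp this).symm

theorem mul_comm_of_rank_le_one (hX : Module.rank 𝕜 X ≤ 1) (S T : X →L[𝕜] X) :
    S * T = T * S := by
  obtain ⟨x, hx⟩ := rank_le_one_iff.mp hX
  ext y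
  obtain ⟨r, rfl⟩ := hx y
  obtain ⟨s, hs⟩ := hx (S x)
  obtain ⟨t, ht⟩ := hx (T x)
  simp [← hs, ← ht, smul_comm s t]

/-- `T₀ S T = (T₀ S) T` is absorbed by the term `δ(S) T`, so `d` itself is the relating derivation.
-/
theorem isAdditiveGeneralizedDerivation_add_mulLeft
    {δ d : A →+ (X →L[𝕜] X)} (hd : ∀ S T, leibnizDefect d S T = 0) {T₀ : X →L[𝕜] X}
    (h : ∀ S : A, δ S = d S + T₀ * S) : IsAdditiveGeneralizedDerivation δ := by
  have hd' : IsAdditiveDerivation d := fun S T => by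
    have := hd S T
    simp only [leibnizDefect] at this
    linear_combination (norm := abel) this
  refine ⟨d, hd', fun S T => ?_⟩
  rw [h, h, hd']
  push_cast
  noncomm_ring

end Operators

end XiLie

theorem theorem3p3 {𝕜 X : Type*} [RCLike 𝕜] [NormedAddCommGroup X] [NormedSpace 𝕜 X]
    [CompleteSpace X] (A : Subalgebra 𝕜 (X →L[𝕜] X)) (hA : XiLie.IsStandardOperatorAlgebra A)
    (ξ : 𝕜) (hξ : ξ ≠ 0) (δ : A →+ (X →L[𝕜] X))
    (hδ : XiLie.IsAdditiveGeneralizedXiLieDerivation ξ δ) :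
    (ξ = 1 → 3 ≤ Module.rank 𝕜 X →
      ∃ (τ : A →+ (X →L[𝕜] X)) (h : A →+ 𝕜),
        XiLie.IsAdditiveGeneralizedDerivation τ ∧
        (∀ S T : A, h (S * T - T * S) = 0) ∧
        ∀ S : A, δ S = τ S + h S • (1 : X →L[𝕜] X)) ∧
    (ξ ≠ 1 →
      XiLie.IsAdditiveGeneralizedDerivation δ ∧
      (Module.rank 𝕜 X ≠ 1 → ∀ S : A, δ (ξ • S) = ξ • δ S)) := by
  obtain ⟨L, hL, hδL⟩ := hδ
  have hA' := hA.actsPrimely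
  have h2 : (2 : 𝕜) ≠ 0 := two_ne_zero
  set T₀ := (δ - L) 1 with hT₀
  have hφ (S : A) : δ S = L S + T₀ * S := by
    have := XiLie.eq_left_mul_of_map_xiBracket (ξ := ξ) (φ := δ - L) (fun S T => by
      rw [AddMonoidHom.sub_apply, hδL, hL]
      simp only [XiLie.xiBracket, AddMonoidHom.sub_apply, sub_mul, smul_sub]
      abel) S
    rw [AddMonoidHom.sub_apply] at this
    linear_combination (norm := abel) this
  refine ⟨fun h1 hX => ?_, fun h1 => ?_⟩
  · subst h1
    obtain ⟨p, hp, hp0, hp1⟩ := hA.exists_idempotent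
      (lt_of_lt_of_le (by norm_num) hX)
    obtain ⟨d, h, hd, hh, hdh⟩ := XiLie.exists_leibniz_add_scalar hA' h2 hp hp0 hp1 (L := L)
      (fun S T => by simpa [XiLie.xiBracket] using hL S T)
    refine ⟨d + (AddMonoidHom.mulLeft T₀).comp A.val.toAddMonoidHom, h,
      XiLie.isAdditiveGeneralizedDerivation_add_mulLeft hd (T₀ := T₀) fun S => rfl, hh,
      fun S => ?_⟩
    rw [hφ, hdh]
    change _ = d S + T₀ * S + _
    abel
  -- Left multiplication by `T₀` is linear, so homogeneity needs checking only for `L`.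
  · have hhom (h : ∀ S, L (ξ • S) = ξ • L S) (S : A) : δ (ξ • S) = ξ • δ S := by
      rw [hφ, hφ, h]
      simp
    by_cases h3 : 1 + ξ = 0
    · obtain rfl : ξ = -1 := by linear_combination h3
      refine ⟨XiLie.isAdditiveGeneralizedDerivation_add_mulLeft (T₀ := T₀)
        (XiLie.jordan_leibniz hA' h2 fun S T => ?_) hφ, fun _ => hhom fun S => by simp⟩
      have := hL S T
      simp only [XiLie.xiBracket, neg_smul, one_smul, sub_neg_eq_add] at this
      rw [this]
      abel
    · obtain ⟨c, hc, hLc⟩ := XiLie.xiLie_bracket_one hL hA' h3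
      have hdef := XiLie.xiLie_leibnizDefect hL h1 hLc
      by_cases hX : 1 < Module.rank 𝕜 X
      · obtain ⟨p, hp, hp0, hp1⟩ := hA.exists_idempotent hX
        obtain rfl := XiLie.xiLie_scalar_eq_zero hA' (Subtype.ext hp) hp0 hp1 hdef
        refine ⟨XiLie.isAdditiveGeneralizedDerivation_add_mulLeft (T₀ := T₀) (d := L)
          (fun S T => ?_) hφ, fun _ => hhom fun S => by simp [hLc]⟩
        have := hdef S T
        rw [zero_smul, neg_zero] at this
        exact (smul_eq_zero.mp this).resolve_left h3
      · have hcomm := XiLie.mul_comm_of_rank_le_one (not_lt.mp hX)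
        -- In the commutative case the defect of `L` is `-c S T`; moving `c` from `L` into the left
        -- multiplier removes it.
        refine ⟨XiLie.isAdditiveGeneralizedDerivation_add_mulLeft (T₀ := c • 1 + T₀)
          (d := L - (AddMonoidHom.mulLeft (c • 1)).comp A.val.toAddMonoidHom)
          (fun S T => ?_) fun S => ?_, fun hX1 S => ?_⟩
        · apply smul_right_injective _ h3
          have := hdef S T
          rw [hcomm T S] at this
          simp only [XiLie.leibnizDefect] at this ⊢
          simp only [AddMonoidHom.sub_apply]
          change (1 + ξ) • (L (S * T) - c • 1 * (S * T : X →L[𝕜] X)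
            - (L S - c • 1 * (S : X →L[𝕜] X)) * T - S * (L T - c • 1 * (T : X →L[𝕜] X)))
            = (1 + ξ) • 0
          simp only [smul_mul_assoc, one_mul, sub_mul, mul_sub, mul_smul_comm]
          linear_combination (norm := module) this
        · rw [hφ]
          change _ = L S - c • 1 * (S : X →L[𝕜] X) + _
          rw [add_mul]
          abel
        · have h0 : Module.rank 𝕜 X = 0 := by
            rw [← Cardinal.lt_one_iff]
            exact lt_of_le_of_ne (not_lt.mp hX) hX1
          have := rank_zero_iff.mp h0
          exact ContinuousLinearMap.ext fun x => Subsingleton.elim _ _
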